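/- For a meromorphic function $\phi$ on $\mathbb{C}$ let $T(r,\phi)=m(r,\phi)+N(r,\phi)$ be its Nevanlinna characteristic (proximity function plus integrated pole-counting function), and let $\rho(\phi)=\limsup_{r\to\infty}\frac{\log T(r,\phi)}{\log r}$ be its Nevanlinna order (with $\rho(\phi)=0$ for constant $\phi$). (i) The Riemann zeta function satisfies no nontrivial algebraic difference equation whose coefficients are meromorphic functions of order less than $1$. That is, let $m\ge 0$ be an integer, let $s_0,\dots,s_m$ be distinct complex numbers, and let $f(s,z_0,\dots,z_m)$ be a polynomial in $z_0,\dots,z_m$ whose coefficients are meromorphic functions $\phi$ of $s$ on $\mathbb{C}$ with $\rho(\phi)<1$. If $$f\bigl(s,\zeta(s+s_0),\zeta(s+s_1),\dots,\zeta(s+s_m)\bigr)=0$$ identically in $s\in\mathbb{C}$ (as meromorphic functions), then all coefficients of $f$ vanish identically. (ii) The condition $\rho(\phi)<1$ cannot be relaxed to $\rho(\phi)\le 1$: one has $\rho\bigl(\zeta(s+1)/\zeta(s)\bigr)=1$, and $\zeta$ satisfies a nontrivial algebraic difference equation of the form in (i) whose coefficients are meromorphic functions of order at most $1$. -/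

import Mathlib

open Filter Topology

/-- The Nevanlinna order `ρ(φ) = limsup_{r → ∞} log T(r, φ) / log r` of a meromorphic function on
the complex plane, as an extended real number. Here `T(r, φ) = m(r, φ) + N(r, φ)` is the Nevanlinna
characteristic (the proximity function plus the pole counting function). For a meromorphic `φ` the
value `T(r, φ)` can vanish for large `r` only if it vanishes for all `r ≥ 1`; then `φ` is constant
and, as `Real.log 0 = 0`, its order is `0`, as it is for every other constant. -/
noncomputable def nevanlinnaOrder (φ : ℂ → ℂ) : EReal :=
  limsup (fun r : ℝ ↦
    ((Real.log (ValueDistribution.characteristic φ ⊤ r) / Real.log r : ℝ) : EReal)) atTop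

/-- `y` satisfies a nontrivial algebraic difference equation with meromorphic coefficients that
belong to the class `C`: there are distinct complex shifts `a 0, …, a m` and a polynomial `f` in
`m + 1` variables, with meromorphic coefficients from `C` that do not all vanish identically, such
that `f (s, y (s + a 0), …, y (s + a m)) = 0`.

Identities between meromorphic functions are identities off a closed discrete set, since the
functions carry no meaningful values at their poles. -/
def SatisfiesAlgebraicDifferenceEquation (C : Set (ℂ → ℂ)) (y : ℂ → ℂ) : Prop :=
  ∃ (m : ℕ) (a : Fin (m + 1) → ℂ) (f : MvPolynomial (Fin (m + 1)) (ℂ → ℂ)),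
    Function.Injective a ∧
    (∀ K, Meromorphic (f.coeff K) ∧ f.coeff K ∈ C) ∧
    (∃ K, ¬ f.coeff K =ᶠ[codiscrete ℂ] 0) ∧
    MvPolynomial.eval (fun i s ↦ y (s + a i)) f =ᶠ[codiscrete ℂ] 0

/-! Impossibility. Expanding the polynomial over its monomials turns the equation into a relation `∑
c_K(s) D_K(s) = 0`, where `D_K = ∏ ζ(s + a_i) ^ K_i` is a Dirichlet series far to the right. Order
less than one gives `T(r, c_K) = o(r)`, so by averaging over an arc every large circle carries a
point `z` with `Re z ≥ r / 2` at which the `c_K`, and also the inverse of any nonzero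
constant-coefficient combination of them, are at most `exp (ε r)`. Passing from `N ^ (-z)` to `(N +
1) ^ (-z)` gains a factor exponentially small in `r`, which beats these bounds. Hence the relation
splits: `∑ c_K(s) D_K(n) = 0` for each Dirichlet coefficient `n`
(`sum_mul_coeff_eventuallyEq_zero`).

Fixing a generic `s` leaves a linear relation over `ℂ` between the multiplicative functions `n ↦
D_K(n)`. Their local factors `∏ (1 - p ^ (-a_i) X) ^ (-K_i)` determine `K` at all but finitely many
primes, so Artin's argument for independence of characters applies
(`zetaMonomial_linearIndependent`).

Sharpness. `φ(s) = ζ(s + 1) / ζ(s)` makes `ζ(s + 1) = φ(s) ζ(s)` a nontrivial equation. Since `(s -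
1) ζ(s)` is `exp (O(r log r))`, the order of `φ` is at most one. The lower bound needs no estimate:
a smaller order would contradict the impossibility result. -/

section

/-! ### Characteristics of size `o(r)` -/

open scoped Real
open ValueDistribution MeasureTheory Asymptotics

/-- A function of Nevanlinna order less than one has characteristic `T(r) = o(r)`. -/
theorem characteristic_isLittleO_of_nevanlinnaOrder_lt_one {φ : ℂ → ℂ}
    (h : nevanlinnaOrder φ < 1) : characteristic φ ⊤ =o[atTop] (fun r : ℝ ↦ r) := by
  obtain ⟨q, hq₁, hq₂⟩ := EReal.lt_iff_exists_real_btwn.1 h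
  have hq : q < 1 := by exact_mod_cast hq₂
  refine IsBigO.trans_isLittleO (g := fun r : ℝ ↦ r ^ q) (.of_bound 1 ?_) ?_
  · filter_upwards [eventually_lt_of_limsup_lt hq₁, eventually_gt_atTop (1 : ℝ)] with r hr hr₁
    have hlog : 0 < Real.log r := Real.log_pos hr₁
    have hr' : Real.log (characteristic φ ⊤ r) / Real.log r < q := by exact_mod_cast hr
    rw [div_lt_iff₀ hlog] at hr'
    have hnn : 0 ≤ characteristic φ ⊤ r := characteristic_nonneg hr₁.le
    rw [Real.norm_of_nonneg hnn, Real.norm_of_nonneg (by positivity), one_mul]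
    -- Since `Real.log 0 = 0`, the logarithmic bound says nothing when the characteristic vanishes.
    rcases hnn.eq_or_lt with h0 | h0
    · rw [← h0]; positivity
    · rw [Real.le_rpow_iff_log_le h0 (by linarith)]
      exact hr'.le
  · refine isLittleO_of_tendsto' ?_ ?_
    · filter_upwards [eventually_gt_atTop (0 : ℝ)] with r hr h0 using absurd h0 hr.ne'
    · refine (tendsto_rpow_neg_atTop (sub_pos.2 hq)).congr' ?_
      filter_upwards [eventually_gt_atTop (0 : ℝ)] with r hr
      rw [neg_sub, Real.rpow_sub hr, Real.rpow_one]

theorem log_characteristic_div_log_le {φ : ℂ → ℂ} {q r : ℝ} (hr : 1 < r)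
    (hq : 0 ≤ q) (h : characteristic φ ⊤ r ≤ r ^ q) :
    Real.log (characteristic φ ⊤ r) / Real.log r ≤ q := by
  have hlog : 0 < Real.log r := Real.log_pos hr
  rw [div_le_iff₀ hlog]
  rcases (characteristic_nonneg (f := φ) (a := ⊤) hr.le).eq_or_lt with h0 | h0
  · rw [← h0, Real.log_zero]; positivity
  · exact (Real.le_rpow_iff_log_le h0 (by linarith)).1 h

/-- Polynomial growth of the characteristic bounds the Nevanlinna order. -/
theorem nevanlinnaOrder_le_of_forall_gt {φ : ℂ → ℂ} {p : ℝ} (hp : 0 ≤ p)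
    (h : ∀ q > p, ∀ᶠ r : ℝ in atTop, characteristic φ ⊤ r ≤ r ^ q) :
    nevanlinnaOrder φ ≤ p := by
  refine EReal.le_of_forall_lt_iff_le.1 fun q hq ↦ ?_
  have hq' : p < q := by exact_mod_cast hq
  refine limsup_le_of_le (by isBoundedDefault) ?_
  filter_upwards [h q hq', eventually_gt_atTop 1] with r hr hr₁
  exact_mod_cast log_characteristic_div_log_le hr₁ (hp.trans hq'.le) hr

theorem nevanlinnaOrder_const_of_norm_le_one {c : ℂ} (hc : ‖c‖ ≤ 1) :
    nevanlinnaOrder (fun _ ↦ c) = 0 := by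
  have : ∀ r, characteristic (fun _ : ℂ ↦ c) ⊤ r = 0 := fun r ↦ by
    simp [characteristic, Real.posLog_eq_zero_iff, abs_of_nonneg, hc]
  simp [nevanlinnaOrder, this]

/-- By the identity theorem on the connected plane, infinite order at one point forces infinite
order everywhere, that is, vanishing off a discrete set. -/
theorem Meromorphic.forall_meromorphicOrderAt_ne_top {f : ℂ → ℂ} (hf : Meromorphic f)
    (h : ¬ f =ᶠ[codiscrete ℂ] 0) : ∀ z, meromorphicOrderAt f z ≠ ⊤ := by
  rw [← hf.exists_meromorphicOrderAt_ne_top_iff_forall]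
  contrapose! h
  change {z | f z = 0} ∈ codiscreteWithin Set.univ
  rw [mem_codiscreteWithin_iff_forall_mem_nhdsNE]
  intro z _
  rw [Set.compl_univ, Set.union_empty]
  exact meromorphicOrderAt_eq_top_iff.1 (h z)

/-- A meromorphic function that does not vanish identically is nonzero off a discrete set. -/
theorem Meromorphic.eventually_codiscrete_ne_zero {f : ℂ → ℂ} (hf : Meromorphic f)
    (h : ¬ f =ᶠ[codiscrete ℂ] 0) : ∀ᶠ z in codiscrete ℂ, f z ≠ 0 := by
  have htop := hf.forall_meromorphicOrderAt_ne_top h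
  change {z | f z ≠ 0} ∈ codiscreteWithin Set.univ
  rw [mem_codiscreteWithin_iff_forall_mem_nhdsNE]
  intro z _
  rw [Set.compl_univ, Set.union_empty]
  exact (meromorphicOrderAt_ne_top_iff_eventually_ne_zero (hf z)).1 (htop z)

theorem Meromorphic.const_mul_sum {ι : Type*} (s : Finset ι) {c : ι → ℂ → ℂ} (d : ι → ℂ)
    (hc : ∀ i ∈ s, Meromorphic (c i)) : Meromorphic (∑ i ∈ s, fun z ↦ c i z * d i) := by
  refine Meromorphic.sum fun i hi ↦ ?_
  exact (hc i hi).mul (Meromorphic.const _)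

theorem characteristic_mul_const_isLittleO {f : ℂ → ℂ} (d : ℂ) (hf : Meromorphic f)
    (ho : characteristic f ⊤ =o[atTop] (fun r : ℝ ↦ r)) :
    characteristic (fun z ↦ f z * d) ⊤ =o[atTop] (fun r : ℝ ↦ r) := by
  have hzero : characteristic (0 : ℂ → ℂ) ⊤ = 0 := by
    ext r
    change characteristic (fun _ : ℂ ↦ (0 : ℂ)) ⊤ r = 0
    simp [characteristic]
  -- The inequality for the characteristic of a product needs both factors to be not identically
  -- zero, so the degenerate cases are separated.
  rcases eq_or_ne d 0 with rfl | hd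
  · have : (fun z ↦ f z * 0) = (0 : ℂ → ℂ) := by ext; simp
    rw [this, hzero]
    exact isLittleO_zero _ _
  by_cases hf0 : f =ᶠ[codiscrete ℂ] 0
  · have h0 : (fun z ↦ f z * d) =ᶠ[codiscrete ℂ] 0 := by
      filter_upwards [hf0] with z hz
      simp [hz]
    refine (isLittleO_zero (fun r : ℝ ↦ r) atTop).congr' ?_ .rfl (f₁ := fun _ ↦ (0 : ℝ))
    filter_upwards [eventually_gt_atTop (0 : ℝ)] with r hr
    rw [characteristic_congr_codiscrete h0 hr.ne', hzero, Pi.zero_apply]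
  · have hb : (characteristic f ⊤ + fun _ ↦ Real.posLog ‖d‖) =o[atTop] (fun r : ℝ ↦ r) :=
      ho.add (isLittleO_const_id_atTop _)
    refine IsBigO.trans_isLittleO (.of_bound 1 ?_) hb
    filter_upwards [eventually_ge_atTop (1 : ℝ)] with r hr
    rw [one_mul, Real.norm_of_nonneg (characteristic_nonneg hr)]
    refine le_trans ?_ (le_abs_self _)
    have := characteristic_mul_top_le hr hf (hf.forall_meromorphicOrderAt_ne_top hf0)
      (Meromorphic.const d) (fun z ↦ by simp [meromorphicOrderAt_const, hd])
    refine this.trans (le_of_eq ?_)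
    simp [characteristic]

theorem characteristic_sum_mul_const_isLittleO {ι : Type*} (s : Finset ι) {c : ι → ℂ → ℂ}
    (d : ι → ℂ) (hc : ∀ i ∈ s, Meromorphic (c i))
    (ho : ∀ i ∈ s, characteristic (c i) ⊤ =o[atTop] (fun r : ℝ ↦ r)) :
    characteristic (∑ i ∈ s, fun z ↦ c i z * d i) ⊤ =o[atTop] (fun r : ℝ ↦ r) := by
  have hm : ∀ i ∈ s, Meromorphic fun z ↦ c i z * d i := fun i hi ↦
    (hc i hi).mul (Meromorphic.const _)
  have hb : (∑ i ∈ s, characteristic (fun z ↦ c i z * d i) ⊤ + fun _ ↦ Real.log s.card)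
      =o[atTop] (fun r : ℝ ↦ r) := by
    refine IsLittleO.add ?_ (isLittleO_const_id_atTop _)
    exact IsLittleO.sum fun i hi ↦ characteristic_mul_const_isLittleO (d i) (hc i hi) (ho i hi)
  refine IsBigO.trans_isLittleO (.of_bound 1 ?_) hb
  filter_upwards [eventually_ge_atTop (1 : ℝ), characteristic_sum_top_eventuallyLE s _ hm]
    with r hr hle
  rw [one_mul, Real.norm_of_nonneg (characteristic_nonneg hr)]
  exact hle.trans (le_abs_self _)

/-- First main theorem: the characteristics of `f` and `1 / f` differ by a bounded amount. -/
theorem characteristic_inv_isLittleO {f : ℂ → ℂ} (hf : Meromorphic f)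
    (ho : characteristic f ⊤ =o[atTop] (fun r : ℝ ↦ r)) :
    characteristic f⁻¹ ⊤ =o[atTop] (fun r : ℝ ↦ r) := by
  have h1 : (characteristic f ⊤ - characteristic f⁻¹ ⊤) =o[atTop] (fun r : ℝ ↦ r) :=
    (isBigO_characteristic_sub_characteristic_inv hf).trans_isLittleO (isLittleO_const_id_atTop _)
  simpa using ho.sub h1

/-- If finitely many meromorphic functions have characteristic `o(r)`, then every large circle
around the origin contains a point deep in the right half-plane, off a given discrete set, at which
all of them are of size at most `exp (ε r)`. -/
theorem eventually_exists_posLog_norm_le {ι : Type*} (s : Finset ι) {h : ι → ℂ → ℂ}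
    (hm : ∀ i ∈ s, Meromorphic (h i))
    (ho : ∀ i ∈ s, characteristic (h i) ⊤ =o[atTop] (fun r : ℝ ↦ r))
    {S : Set ℂ} (hS : S ∈ codiscrete ℂ) {ε : ℝ} (hε : 0 < ε) :
    ∀ᶠ r : ℝ in atTop, ∃ z ∈ S, r / 2 ≤ z.re ∧ ∀ i ∈ s, Real.posLog ‖h i z‖ ≤ ε * r := by
  have hsum : (fun r ↦ ∑ i ∈ s, characteristic (h i) ⊤ r) =o[atTop] (fun r : ℝ ↦ r) := by
    have := IsLittleO.sum ho
    rwa [Finset.sum_fn] at this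
  -- If every admissible point of the arc `0 ≤ θ ≤ π / 3`, where `cos θ ≥ 1 / 2`, were bad, the
  -- integral of `H` would be at least `ε r π / 3`. The characteristics bound it by `2 π ε r / 7`;
  -- any constant below `1 / 6` would do.
  filter_upwards [hsum.def (show 0 < ε / 7 by positivity), eventually_ge_atTop (1 : ℝ)]
    with r hr hr₁
  have hr₀ : 0 < r := by linarith
  rw [Real.norm_of_nonneg (Finset.sum_nonneg fun i _ ↦ characteristic_nonneg hr₁),
    Real.norm_of_nonneg hr₀.le] at hr
  set H : ℝ → ℝ := fun θ ↦ ∑ i ∈ s, Real.posLog ‖h i (circleMap 0 r θ)‖ with hH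
  have hHnn : ∀ θ, 0 ≤ H θ := fun θ ↦ Finset.sum_nonneg fun i _ ↦ Real.posLog_nonneg
  have hint : ∀ i ∈ s, IntervalIntegrable
      (fun θ ↦ Real.posLog ‖h i (circleMap 0 r θ)‖) volume 0 (2 * π) := fun i hi ↦
    MeromorphicOn.circleIntegrable_posLog_norm fun z _ ↦ hm i hi z
  have hHint : IntervalIntegrable H volume 0 (2 * π) := by
    have := IntervalIntegrable.sum s hint
    simpa only [hH, Finset.sum_fn] using this
  have hle : ∫ θ in 0..2 * π, H θ ≤ 2 * π * (ε / 7 * r) := by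
    rw [intervalIntegral.integral_finsetSum hint]
    have : ∀ i ∈ s, ∫ θ in 0..2 * π, Real.posLog ‖h i (circleMap 0 r θ)‖
        ≤ 2 * π * characteristic (h i) ⊤ r := fun i hi ↦ by
      have hp : proximity (h i) ⊤ r ≤ characteristic (h i) ⊤ r := by
        rw [characteristic, Pi.add_apply]
        linarith [logCounting_nonneg (f := h i) (e := ⊤) hr₁]
      rw [proximity_top, Real.circleAverage_def, smul_eq_mul, inv_mul_le_iff₀ (by positivity)]
        at hp
      exact hp
    refine (Finset.sum_le_sum this).trans ?_
    rw [← Finset.mul_sum]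
    gcongr
  by_contra! hcon
  have hS' : ∀ᵐ θ : ℝ, circleMap 0 r θ ∈ S := by
    have h1 : circleMap 0 r ⁻¹' S ∈ codiscrete ℝ :=
      circleMap_preimage_codiscrete hr₀.ne' (codiscreteWithin_mono (Set.subset_univ _) hS)
    have h2 := ae_restrict_le_codiscreteWithin (μ := (volume : Measure ℝ)) MeasurableSet.univ h1
    rwa [Measure.restrict_univ] at h2
  have hlow : ∫ θ in 0..(π / 3), (ε * r) ≤ ∫ θ in 0..(π / 3), H θ := by
    refine intervalIntegral.integral_mono_ae_restrict (by positivity) (by simp)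
      (hHint.mono_set ?_) ?_
    · rw [Set.uIcc_of_le (by positivity), Set.uIcc_of_le (by positivity)]
      exact Set.Icc_subset_Icc_right (by linarith [Real.pi_pos])
    · filter_upwards [ae_restrict_of_ae hS', ae_restrict_mem measurableSet_Icc] with θ hθ hmem
      have hre : r / 2 ≤ (circleMap 0 r θ).re := by
        have : Real.cos (π / 3) ≤ Real.cos θ :=
          Real.cos_le_cos_of_nonneg_of_le_pi hmem.1 (by linarith [Real.pi_pos]) hmem.2
        rw [Real.cos_pi_div_three] at this
        have h3 : (circleMap 0 r θ).re = r * Real.cos θ := by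
          simp [circleMap, Complex.exp_ofReal_mul_I_re]
        rw [h3]
        nlinarith
      obtain ⟨i, hi, hlt⟩ := hcon _ hθ hre
      exact hlt.le.trans (Finset.single_le_sum
        (f := fun i ↦ Real.posLog ‖h i (circleMap 0 r θ)‖) (fun _ _ ↦ Real.posLog_nonneg) hi)
  have hmono : ∫ θ in 0..(π / 3), H θ ≤ ∫ θ in 0..2 * π, H θ :=
    intervalIntegral.integral_mono_interval le_rfl (by positivity) (by linarith [Real.pi_pos])
      (ae_of_all _ hHnn) hHint
  rw [intervalIntegral.integral_const, smul_eq_mul] at hlow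
  have : 0 < π * (ε * r) := by positivity
  nlinarith

end

/-! ### Linear independence of the Dirichlet coefficients -/

section

open ArithmeticFunction

/-- **Artin's argument**: multiplicative functions that can be told apart pairwise at prime powers
coprime to any given integer are linearly independent, even on the integers coprime to a given
one. -/
theorem ArithmeticFunction.eq_zero_of_sum_mul_eq_zero {ι : Type*} {g : ι → ArithmeticFunction ℂ}
    (hg : ∀ i, (g i).IsMultiplicative)
    (hsep : ∀ i j, i ≠ j → ∀ M : ℕ, M ≠ 0 → ∃ q : ℕ, q ≠ 0 ∧ q.Coprime M ∧ g i q ≠ g j q)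
    (s : Finset ι) : ∀ (b : ι → ℂ) (M : ℕ), M ≠ 0 →
      (∀ n : ℕ, n.Coprime M → ∑ i ∈ s, b i * g i n = 0) → ∀ i ∈ s, b i = 0 := by
  classical
  induction s using Finset.induction_on with
  | empty => simp
  | insert j s hj ih =>
    intro b M hM hb
    have key : ∀ i ∈ s, b i = 0 := by
      intro i hi
      -- The relation at `q * n` minus `g j q` times the relation at `n` eliminates `j` and
      -- multiplies each `b l` by `g l q - g j q`. It holds for `n` coprime to `M * q`, which is why
      -- the induction carries `M`.
      obtain ⟨q, hq0, hqM, hne⟩ := hsep i j (fun h ↦ hj (h ▸ hi)) M hM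
      have := ih (fun l ↦ b l * (g l q - g j q)) (M * q) (mul_ne_zero hM hq0) (fun n hn ↦ ?_) i hi
      · exact (mul_eq_zero.1 this).resolve_right (sub_ne_zero.2 hne)
      · have hnM : n.Coprime M := Nat.Coprime.coprime_mul_right_right hn
        have hnq : n.Coprime q := Nat.Coprime.coprime_mul_left_right hn
        have h1 := hb n hnM
        have h2 := hb (q * n) (Nat.Coprime.mul_left hqM hnM)
        rw [Finset.sum_insert hj] at h1 h2
        rw [(hg j).map_mul_of_coprime hnq.symm] at h2
        have h3 : ∑ l ∈ s, b l * (g l) (q * n) = ∑ l ∈ s, b l * g l q * g l n :=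
          Finset.sum_congr rfl fun l _ ↦ by rw [(hg l).map_mul_of_coprime hnq.symm]; ring
        have h4 : ∑ l ∈ s, b l * (g l q - g j q) * g l n
            = ∑ l ∈ s, b l * g l q * g l n - g j q * ∑ l ∈ s, b l * g l n := by
          rw [Finset.mul_sum, ← Finset.sum_sub_distrib]
          exact Finset.sum_congr rfl fun l _ ↦ by ring
        rw [h4, ← h3]
        linear_combination h2 - g j q * h1
    intro i hi
    rcases Finset.mem_insert.1 hi with rfl | hi
    · have := hb 1 (Nat.coprime_one_left M)
      rw [Finset.sum_insert hj, Finset.sum_eq_zero fun l hl ↦ by rw [key l hl, zero_mul]] at this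
      simpa [(hg i).map_one] using this
    · exact key i hi

/-- The arithmetic function `n ↦ n ^ (-a)`, whose L-series is `ζ (s + a)`. -/
noncomputable def negCpow (a : ℂ) : ArithmeticFunction ℂ :=
  ⟨fun n ↦ if n = 0 then 0 else (n : ℂ) ^ (-a), by simp⟩

theorem negCpow_apply {a : ℂ} {n : ℕ} (hn : n ≠ 0) : negCpow a n = (n : ℂ) ^ (-a) := by
  simp [negCpow, hn]

theorem negCpow_mul (a : ℂ) (m n : ℕ) : negCpow a (m * n) = negCpow a m * negCpow a n := by
  rcases eq_or_ne m 0 with rfl | hm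
  · simp
  rcases eq_or_ne n 0 with rfl | hn
  · simp
  rw [negCpow_apply hm, negCpow_apply hn, negCpow_apply (mul_ne_zero hm hn), Nat.cast_mul,
    Complex.natCast_mul_natCast_cpow]

theorem isMultiplicative_negCpow (a : ℂ) : (negCpow a).IsMultiplicative :=
  ⟨by simp [negCpow_apply], fun {m n} _ ↦ negCpow_mul a m n⟩

theorem LSeriesHasSum_negCpow {a s : ℂ} (h : 1 < (s + a).re) :
    LSeriesHasSum (negCpow a) s (riemannZeta (s + a)) := by
  rw [zeta_eq_tsum_one_div_nat_cpow h]
  have : LSeries.term (negCpow a) s = fun n : ℕ ↦ 1 / (n : ℂ) ^ (s + a) := by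
    ext n
    rcases eq_or_ne n 0 with rfl | hn
    · have : s + a ≠ 0 := fun h0 ↦ by rw [h0] at h; norm_num at h
      simp [this]
    · have hn' : (n : ℂ) ≠ 0 := by exact_mod_cast hn
      rw [LSeries.term_of_ne_zero hn, negCpow_apply hn, Complex.cpow_neg, Complex.cpow_add _ _ hn']
      field_simp
  rw [LSeriesHasSum, this]
  exact (Complex.summable_one_div_nat_cpow.2 h).hasSum

/-- The Dirichlet coefficients of the monomial `∏ i, ζ (s + a i) ^ K i`. -/
noncomputable def zetaMonomial {σ : Type*} [Fintype σ] (a : σ → ℂ) (K : σ →₀ ℕ) :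
    ArithmeticFunction ℂ :=
  ∏ i, negCpow (a i) ^ K i

theorem isMultiplicative_pow {f : ArithmeticFunction ℂ} (hf : f.IsMultiplicative) (k : ℕ) :
    (f ^ k).IsMultiplicative := by
  induction k with
  | zero => simp [isMultiplicative_one]
  | succ k ih => rw [pow_succ]; exact ih.mul hf

theorem isMultiplicative_zetaMonomial {σ : Type*} [Fintype σ] (a : σ → ℂ) (K : σ →₀ ℕ) :
    (zetaMonomial a K).IsMultiplicative :=
  isMultiplicative_finsetProd _ _ fun _ _ ↦ isMultiplicative_pow (isMultiplicative_negCpow _) _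

theorem LSeriesHasSum_one_arithmeticFunction (s : ℂ) :
    LSeriesHasSum (1 : ArithmeticFunction ℂ) s 1 := by
  have : LSeries.term (1 : ArithmeticFunction ℂ) s = fun n ↦ if n = 1 then 1 else 0 := by
    ext n
    rcases eq_or_ne n 0 with rfl | hn
    · simp
    · rw [LSeries.term_of_ne_zero hn, one_apply]
      split_ifs with h <;> simp [h]
  rw [LSeriesHasSum, this]
  exact hasSum_ite_eq 1 1

theorem LSeriesHasSum_pow_arithmeticFunction {f : ArithmeticFunction ℂ} {s z : ℂ}
    (h : LSeriesHasSum f s z) (k : ℕ) :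
    LSeriesHasSum (f ^ k : ArithmeticFunction ℂ) s (z ^ k) := by
  induction k with
  | zero => simpa only [pow_zero] using LSeriesHasSum_one_arithmeticFunction s
  | succ k ih => rw [pow_succ, pow_succ]; exact LSeriesHasSum_mul ih h

theorem LSeriesHasSum_zetaMonomial {σ : Type*} [Fintype σ] {a : σ → ℂ} (K : σ →₀ ℕ) {s : ℂ}
    (h : ∀ i, 1 < (s + a i).re) :
    LSeriesHasSum (zetaMonomial a K) s (∏ i, riemannZeta (s + a i) ^ K i) := by
  classical
  unfold zetaMonomial
  induction (Finset.univ : Finset σ) using Finset.induction_on with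
  | empty => simpa only [Finset.prod_empty] using LSeriesHasSum_one_arithmeticFunction s
  | insert i t hi ih =>
    rw [Finset.prod_insert hi, Finset.prod_insert hi]
    exact LSeriesHasSum_mul (LSeriesHasSum_pow_arithmeticFunction (LSeriesHasSum_negCpow (h i)) _) ih

/-- The local factor at `p` of an arithmetic function, as a power series in `X = p ^ (-s)`. -/
noncomputable def localSeries {p : ℕ} (hp : p.Prime) : ArithmeticFunction ℂ →* PowerSeries ℂ where
  toFun f := PowerSeries.mk fun k ↦ f (p ^ k)
  map_one' := by
    ext k
    rw [PowerSeries.coeff_mk, PowerSeries.coeff_one, one_apply]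
    simp [hp.ne_one]
  map_mul' f g := by
    ext k
    rw [PowerSeries.coeff_mk, PowerSeries.coeff_mul, ArithmeticFunction.mul_apply,
      Nat.sum_divisorsAntidiagonal (f := fun i j ↦ f i * g j), Nat.sum_divisors_prime_pow hp,
      Finset.Nat.sum_antidiagonal_eq_sum_range_succ
        (fun i j ↦ PowerSeries.coeff i (PowerSeries.mk fun k ↦ f (p ^ k)) *
          PowerSeries.coeff j (PowerSeries.mk fun k ↦ g (p ^ k)))]
    refine Finset.sum_congr rfl fun i hi ↦ ?_
    rw [PowerSeries.coeff_mk, PowerSeries.coeff_mk,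
      Nat.pow_div (Nat.lt_succ_iff.1 (Finset.mem_range.1 hi)) hp.pos]

/-- The local series is geometric with ratio `p ^ (-a) X`. Its inverse is a polynomial, from whose
roots exponents can be read off. -/
theorem localSeries_negCpow_mul {p : ℕ} (hp : p.Prime) (a : ℂ) :
    localSeries hp (negCpow a) *
      ((1 - Polynomial.C ((p : ℂ) ^ (-a)) * Polynomial.X : Polynomial ℂ) : PowerSeries ℂ) = 1 := by
  have h : ∀ k, negCpow a (p ^ k) = ((p : ℂ) ^ (-a)) ^ k := fun k ↦ by
    induction k with
    | zero => simp [negCpow_apply]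
    | succ k ih => rw [pow_succ, negCpow_mul, ih, negCpow_apply hp.ne_zero, pow_succ]
  ext k
  simp only [localSeries, MonoidHom.coe_mk, OneHom.coe_mk, h, Polynomial.coe_sub, Polynomial.coe_one,
    Polynomial.coe_mul, Polynomial.coe_C, Polynomial.coe_X, mul_sub, mul_one, map_sub,
    PowerSeries.coeff_mk]
  rcases k with _ | k
  · simp
  · rw [← mul_assoc, PowerSeries.coeff_succ_mul_X, PowerSeries.coeff_mul_C, PowerSeries.coeff_mk,
      PowerSeries.coeff_one, pow_succ]
    simp

/-- The exponent at `j` is the multiplicity of the root `(x j)⁻¹`, and these roots are distinct. -/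
theorem prod_one_sub_C_mul_X_pow_injective {σ : Type*} [Fintype σ] {x : σ → ℂ}
    (hx0 : ∀ i, x i ≠ 0) (hx : Function.Injective x) {K L : σ →₀ ℕ}
    (h : ∏ i, (1 - Polynomial.C (x i) * Polynomial.X) ^ K i =
      ∏ i, (1 - Polynomial.C (x i) * Polynomial.X) ^ L i) : K = L := by
  classical
  have hroots : ∀ (N : σ →₀ ℕ) (j : σ),
      ((∏ i, (1 - Polynomial.C (x i) * Polynomial.X) ^ N i).roots).count (x j)⁻¹ = N j := by
    intro N j
    have hne : ∀ i, (1 - Polynomial.C (x i) * Polynomial.X) ≠ 0 := fun i h0 ↦ by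
      simpa using congrArg (Polynomial.eval 0) h0
    have hr : ∀ i, (1 - Polynomial.C (x i) * Polynomial.X).roots = {(x i)⁻¹} := fun i ↦ by
      have : (1 - Polynomial.C (x i) * Polynomial.X)
          = Polynomial.C (-x i) * Polynomial.X + Polynomial.C 1 := by
        simp; ring
      rw [this, Polynomial.roots_C_mul_X_add_C _ (neg_ne_zero.2 (hx0 i))]
      simp [inv_neg]
    rw [Polynomial.roots_prod _ _ (Finset.prod_ne_zero_iff.2 fun i _ ↦ pow_ne_zero _ (hne i)),
      Multiset.count_bind]
    simp only [Polynomial.roots_pow, hr, Multiset.count_nsmul, Multiset.count_singleton]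
    change ∑ i, _ = _
    rw [Finset.sum_eq_single j]
    · simp
    · intro i _ hij
      rw [if_neg fun h ↦ hij (hx (inv_injective h)).symm, mul_zero]
    · simp
  ext j
  rw [← hroots K j, h, hroots L j]

/-- Distinct exponents give distinct local factors at a prime that separates the shifts. -/
theorem exists_zetaMonomial_prime_pow_ne {σ : Type*} [Fintype σ] {a : σ → ℂ} {p : ℕ}
    (hp : p.Prime) (ha : Function.Injective fun i ↦ (p : ℂ) ^ (-a i)) {K L : σ →₀ ℕ}
    (hKL : K ≠ L) : ∃ k, zetaMonomial a K (p ^ k) ≠ zetaMonomial a L (p ^ k) := by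
  by_contra! hcon
  refine hKL (prod_one_sub_C_mul_X_pow_injective (x := fun i ↦ (p : ℂ) ^ (-a i))
    (fun i ↦ ?_) ha ?_)
  · rw [Ne, Complex.cpow_eq_zero_iff]
    exact fun h ↦ hp.ne_zero (by exact_mod_cast h.1)
  set U : σ → Polynomial ℂ := fun i ↦ 1 - Polynomial.C ((p : ℂ) ^ (-a i)) * Polynomial.X
  have hloc : localSeries hp (zetaMonomial a K) = localSeries hp (zetaMonomial a L) := by
    ext k; simpa [localSeries] using hcon k
  have hone : ∀ N : σ →₀ ℕ, localSeries hp (zetaMonomial a N) *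
      ((∏ i, U i ^ N i : Polynomial ℂ) : PowerSeries ℂ) = 1 := by
    intro N
    have : ((∏ i, U i ^ N i : Polynomial ℂ) : PowerSeries ℂ)
        = ∏ i, ((U i : PowerSeries ℂ)) ^ N i := by
      rw [← Polynomial.coeToPowerSeries.ringHom_apply, map_prod]
      simp
    rw [this, zetaMonomial, map_prod, ← Finset.prod_mul_distrib]
    refine Finset.prod_eq_one fun i _ ↦ ?_
    rw [map_pow, ← mul_pow, localSeries_negCpow_mul hp, one_pow]
  have h1 := hone K
  have h2 := hone L
  rw [hloc] at h1
  apply Polynomial.coe_injective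
  -- Both polynomials invert the same local series, hence coincide.
  calc ((∏ i, U i ^ K i : Polynomial ℂ) : PowerSeries ℂ)
      = (localSeries hp (zetaMonomial a L) * ((∏ i, U i ^ L i : Polynomial ℂ) : PowerSeries ℂ))
          * ((∏ i, U i ^ K i : Polynomial ℂ) : PowerSeries ℂ) := by rw [h2, one_mul]
    _ = (localSeries hp (zetaMonomial a L) * ((∏ i, U i ^ K i : Polynomial ℂ) : PowerSeries ℂ))
          * ((∏ i, U i ^ L i : Polynomial ℂ) : PowerSeries ℂ) := by ring
    _ = _ := by rw [h1, one_mul]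

/-- Two distinct exponents agree at no more than one prime. -/
theorem subsingleton_primes_cpow_neg_eq {a b : ℂ} (hab : a ≠ b) :
    {p : ℕ | p.Prime ∧ (p : ℂ) ^ (-a) = (p : ℂ) ^ (-b)}.Subsingleton := by
  -- Agreement at `p` makes `(b - a) log p` a nonzero integer multiple of `2πi`. Two such primes
  -- would have `log p / log q` rational, giving `p ^ |l| = q ^ |k|` and so `p = q`.
  have key : ∀ p : ℕ, p.Prime → (p : ℂ) ^ (-a) = (p : ℂ) ^ (-b) →
      ∃ k : ℤ, k ≠ 0 ∧ (b - a) * Real.log p = k * (2 * Real.pi * Complex.I) := by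
    intro p hp h
    have hp0 : (p : ℂ) ≠ 0 := by exact_mod_cast hp.ne_zero
    rw [Complex.cpow_def_of_ne_zero hp0, Complex.cpow_def_of_ne_zero hp0,
      Complex.exp_eq_exp_iff_exists_int] at h
    obtain ⟨k, hk⟩ := h
    rw [← Complex.natCast_log] at hk
    have hk' : (b - a) * Real.log p = k * (2 * Real.pi * Complex.I) := by linear_combination hk
    refine ⟨k, ?_, hk'⟩
    rintro rfl
    have hl : (Real.log p : ℂ) ≠ 0 := by
      exact_mod_cast (Real.log_pos (by exact_mod_cast hp.one_lt)).ne'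
    rw [Int.cast_zero, zero_mul] at hk'
    exact mul_ne_zero (sub_ne_zero.2 hab.symm) hl hk'
  rintro p ⟨hp, h⟩ q ⟨hq, h'⟩
  obtain ⟨k, hk0, hk⟩ := key p hp h
  obtain ⟨l, hl0, hl⟩ := key q hq h'
  have hc : (b - a) * ((l : ℂ) * Real.log p - k * Real.log q) = 0 := by
    linear_combination (l : ℂ) * hk - k * hl
  have hc' : (l : ℝ) * Real.log p = k * Real.log q := by
    have := (mul_eq_zero.1 hc).resolve_left (sub_ne_zero.2 hab.symm)
    exact_mod_cast sub_eq_zero.1 this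
  have habs : (l.natAbs : ℝ) * Real.log p = k.natAbs * Real.log q := by
    have := congrArg abs hc'
    rw [abs_mul, abs_mul, abs_of_nonneg (Real.log_natCast_nonneg p),
      abs_of_nonneg (Real.log_natCast_nonneg q)] at this
    rwa [Nat.cast_natAbs, Nat.cast_natAbs, Int.cast_abs, Int.cast_abs]
  rw [← Real.log_pow, ← Real.log_pow] at habs
  have hpow : p ^ l.natAbs = q ^ k.natAbs := by
    have := Real.log_injOn_pos (Set.mem_Ioi.2 (by have := hp.pos; positivity))
      (Set.mem_Ioi.2 (by have := hq.pos; positivity)) habs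
    exact_mod_cast this
  have hdvd : p ∣ q ^ k.natAbs := hpow ▸ dvd_pow_self p (Int.natAbs_ne_zero.2 hl0)
  exact (Nat.prime_dvd_prime_iff_eq hp hq).1 (hp.dvd_of_dvd_pow hdvd)

/-- Each of the finitely many pairs of shifts rules out at most one prime, and a prime larger than
`M` is coprime to `M`. -/
theorem exists_prime_coprime_injective_cpow_neg {σ : Type*} [Finite σ] {a : σ → ℂ}
    (ha : Function.Injective a) {M : ℕ} (hM : M ≠ 0) :
    ∃ p : ℕ, p.Prime ∧ p.Coprime M ∧ Function.Injective fun i ↦ (p : ℂ) ^ (-a i) := by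
  have hfin : ((⋃ ij : {ij : σ × σ // ij.1 ≠ ij.2},
      {p : ℕ | p.Prime ∧ (p : ℂ) ^ (-a ij.1.1) = (p : ℂ) ^ (-a ij.1.2)}) ∪ Set.Iic M).Finite :=
    (Set.finite_iUnion fun ij ↦ (subsingleton_primes_cpow_neg_eq fun h ↦ ij.2 (ha h)).finite).union
      (Set.finite_Iic M)
  obtain ⟨p, hp, hnot⟩ := Nat.infinite_setOfPred_prime.exists_notMem_finite hfin
  rw [Set.mem_union, not_or, Set.mem_iUnion, not_exists] at hnot
  refine ⟨p, hp, ?_, fun i j hij ↦ ?_⟩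
  · rw [Nat.Prime.coprime_iff_not_dvd hp]
    exact fun hd ↦ hnot.2 (Nat.le_of_dvd (Nat.pos_of_ne_zero hM) hd)
  · by_contra hne
    exact hnot.1 ⟨(i, j), hne⟩ ⟨hp, hij⟩

/-- The Dirichlet series `∏ i, ζ (s + a i) ^ K i` with distinct shifts `a i` are linearly
independent. -/
theorem zetaMonomial_linearIndependent {σ : Type*} [Fintype σ] {a : σ → ℂ}
    (ha : Function.Injective a) (s : Finset (σ →₀ ℕ)) (b : (σ →₀ ℕ) → ℂ)
    (h : ∀ n : ℕ, ∑ K ∈ s, b K * zetaMonomial a K n = 0) : ∀ K ∈ s, b K = 0 := by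
  refine eq_zero_of_sum_mul_eq_zero (isMultiplicative_zetaMonomial a) (fun K L hKL M hM ↦ ?_) s b 1
    one_ne_zero fun n _ ↦ h n
  obtain ⟨p, hp, hpM, hinj⟩ := exists_prime_coprime_injective_cpow_neg ha hM
  obtain ⟨k, hk⟩ := exists_zetaMonomial_prime_pow_ne hp hinj hKL
  exact ⟨p ^ k, pow_ne_zero _ hp.ne_zero, hpM.pow_left k, hk⟩

end

/-! ### Separating the Dirichlet coefficients; the impossibility result -/

section

open ValueDistribution MeasureTheory Asymptotics

/-- The tail of a Dirichlet series decays like its first term. -/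
theorem norm_tsum_LSeries_term_tail_le {f : ℕ → ℂ} {x : ℝ} (hf : LSeriesSummable f x) {s : ℂ}
    (hs : x ≤ s.re) {N : ℕ} (hN : 0 < N) :
    ‖∑' n, LSeries.term f s (n + N)‖ ≤ (N : ℝ) ^ (x - s.re) * ∑' n, ‖LSeries.term f x n‖ := by
  have hsum : Summable fun n ↦ ‖LSeries.term f x n‖ := hf.norm
  have hsum' : Summable fun n ↦ ‖LSeries.term f x (n + N)‖ := 
    hsum.comp_injective (add_left_injective N)
  have hle : ∀ n, ‖LSeries.term f s (n + N)‖ ≤ (N : ℝ) ^ (x - s.re) * ‖LSeries.term f x (n + N)‖ := by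
    intro n
    have hNle : N ≤ n + N := Nat.le_add_left _ _
    generalize n + N = k at hNle
    have hk : k ≠ 0 := by omega
    have hpos : (0 : ℝ) < k := by exact_mod_cast Nat.pos_of_ne_zero hk
    rw [LSeries.norm_term_eq, LSeries.norm_term_eq, if_neg hk, if_neg hk, Complex.ofReal_re]
    have h1 : (k : ℝ) ^ (x - s.re) ≤ (N : ℝ) ^ (x - s.re) :=
      Real.rpow_le_rpow_of_nonpos (by positivity) (by exact_mod_cast hNle) (by linarith)
    -- Only the factor `k ^ (x - Re s)` depends on `s`, and it is largest at the first index of the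
    -- tail.
    have h2 : ‖f k‖ / (k : ℝ) ^ s.re = (k : ℝ) ^ (x - s.re) * (‖f k‖ / (k : ℝ) ^ x) := by
      rw [Real.rpow_sub hpos]; field_simp
    rw [h2]
    exact mul_le_mul_of_nonneg_right h1 (by positivity)
  have htail : ∑' n, ‖LSeries.term f x (n + N)‖ ≤ ∑' n, ‖LSeries.term f x n‖ := by
    rw [← Summable.sum_add_tsum_nat_add (f := fun n ↦ ‖LSeries.term f x n‖) N hsum]
    exact le_add_of_nonneg_left (Finset.sum_nonneg fun _ _ ↦ norm_nonneg _)
  refine (tsum_of_norm_bounded (hsum'.mul_left _).hasSum hle).trans ?_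
  rw [tsum_mul_left]
  exact mul_le_mul_of_nonneg_left htail (by positivity)

/-- A linear relation between Dirichlet series, with meromorphic coefficients whose characteristic
is `o(r)`, holds for each Dirichlet coefficient separately. -/
theorem sum_mul_coeff_eventuallyEq_zero {ι : Type*} (s : Finset ι) {c : ι → ℂ → ℂ}
    (hc : ∀ i ∈ s, Meromorphic (c i))
    (ho : ∀ i ∈ s, characteristic (c i) ⊤ =o[atTop] (fun r : ℝ ↦ r))
    {D : ι → ℕ → ℂ} {x : ℝ} (hD : ∀ i ∈ s, LSeriesSummable (D i) x)
    (hrel : ∀ᶠ z in codiscrete ℂ, x ≤ z.re → ∑ i ∈ s, c i z * LSeries (D i) z = 0) {n : ℕ}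
    (hn : n ≠ 0) : (∑ i ∈ s, fun z ↦ c i z * D i n) =ᶠ[codiscrete ℂ] 0 := by
  classical
  induction n using Nat.strong_induction_on with
  | _ N ih =>
  by_contra hA
  set A : ℂ → ℂ := ∑ i ∈ s, fun z ↦ c i z * D i N with hAdef
  have hAm : Meromorphic A := Meromorphic.const_mul_sum s _ hc
  have hAo := characteristic_inv_isLittleO hAm
    (characteristic_sum_mul_const_isLittleO s (fun i ↦ D i N) hc ho)
  have hAne := hAm.eventually_codiscrete_ne_zero hA
  have hsmall : ∀ᶠ z in codiscrete ℂ, ∀ k ∈ Finset.range N, k ≠ 0 → ∑ i ∈ s, c i z * D i k = 0 := by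
    rw [Filter.eventually_all_finset]
    intro k hk
    rcases eq_or_ne k 0 with rfl | hk0
    · exact Eventually.of_forall fun z h ↦ absurd rfl h
    · filter_upwards [ih k (Finset.mem_range.1 hk) hk0] with z hz _
      simpa using hz
  set M : ℝ := ∑ i ∈ s, ∑' n, ‖LSeries.term (D i) x n‖ with hM
  have hM0 : 0 ≤ M := Finset.sum_nonneg fun _ _ ↦ tsum_nonneg fun _ ↦ norm_nonneg _
  have hNpos : (0 : ℝ) < N := by exact_mod_cast Nat.pos_of_ne_zero hn
  -- `δ` is the rate gained from `N` to `N + 1`. The bounds on the coefficients and on `A⁻¹` cost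
  -- `exp (δ r / 8)` each, while `Re z ≥ r / 2` gains `exp (δ r / 2)`. A surplus `exp (δ r / 4)`
  -- remains and would have to stay below the constant `M (N + 1) ^ x`.
  set δ : ℝ := Real.log ((N + 1 : ℕ) : ℝ) - Real.log N with hδ
  have hδ0 : 0 < δ := sub_pos.2 (Real.log_lt_log hNpos (by push_cast; linarith))
  -- the coefficients together with the inverse of the leading one
  have hsel := eventually_exists_posLog_norm_le (Finset.insertNone s)
    (h := fun o : Option ι ↦ o.elim A⁻¹ c) (fun o ho' ↦ ?_) (fun o ho' ↦ ?_)
    (hrel.and (hAne.and hsmall)) (show 0 < δ / 8 by positivity)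
  rotate_left
  · rcases o with _ | i
    · exact hAm.inv
    · exact hc i (by simpa using ho')
  · rcases o with _ | i
    · exact hAo
    · exact ho i (by simpa using ho')
  have hlarge : ∀ᶠ r : ℝ in atTop, M * Real.exp (x * Real.log ((N + 1 : ℕ) : ℝ)) <
      Real.exp (δ / 4 * r) := by
    refine (Real.tendsto_exp_atTop.comp
      (tendsto_id.const_mul_atTop (show 0 < δ / 4 by positivity))).eventually_gt_atTop _
  obtain ⟨r, ⟨z, ⟨hz1, hz2, hz3⟩, hre, hlog⟩, hr, hrx⟩ :=
    (hsel.and (hlarge.and (eventually_ge_atTop (max 0 (2 * x))))).exists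
  have hr0 : 0 ≤ r := (le_max_left _ _).trans hrx
  have hxz : x ≤ z.re := by linarith [(le_max_right 0 (2 * x)).trans hrx]
  have hexp : ∀ {y : ℂ}, Real.posLog ‖y‖ ≤ δ / 8 * r → ‖y‖ ≤ Real.exp (δ / 8 * r) := by
    intro y hy
    rcases eq_or_ne y 0 with rfl | hy0
    · simpa using (Real.exp_pos _).le
    · rw [← Real.log_le_iff_le_exp (norm_pos_iff.2 hy0)]
      exact (le_max_right _ _).trans hy
  have hci : ∀ i ∈ s, ‖c i z‖ ≤ Real.exp (δ / 8 * r) := fun i hi ↦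
    hexp (hlog (some i) (by simpa using hi))
  have hAi : ‖A z‖⁻¹ ≤ Real.exp (δ / 8 * r) := by
    simpa using hexp (hlog none (by simp))
  have hsz : ∀ i ∈ s, LSeriesSummable (D i) z := fun i hi ↦
    (hD i hi).of_re_le_re (by simpa using hxz)
  -- By the induction hypothesis the terms below `N` cancel, so the `N`th term must balance the
  -- tail.
  have hlead : A z * (N : ℂ) ^ (-z) = -∑ i ∈ s, c i z * ∑' n, LSeries.term (D i) z (n + (N + 1)) := by
    have h1 := hz1 hxz
    have h2 : ∀ i ∈ s, c i z * LSeries (D i) z = c i z * ∑ k ∈ Finset.range (N + 1),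
        LSeries.term (D i) z k + c i z * ∑' n, LSeries.term (D i) z (n + (N + 1)) := by
      intro i hi
      rw [← mul_add, (hsz i hi).sum_add_tsum_nat_add (N + 1)]; rfl
    rw [Finset.sum_congr rfl h2, Finset.sum_add_distrib] at h1
    have h3 : ∑ i ∈ s, c i z * ∑ k ∈ Finset.range (N + 1), LSeries.term (D i) z k
        = A z * (N : ℂ) ^ (-z) := by
      simp_rw [Finset.mul_sum]
      rw [Finset.sum_comm, Finset.sum_range_succ, Finset.sum_eq_zero, zero_add]
      · simp only [LSeries.term_of_ne_zero hn, hAdef, Finset.sum_apply, Finset.sum_mul,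
          Complex.cpow_neg]
        exact Finset.sum_congr rfl fun i _ ↦ by ring
      · intro k hk
        rcases eq_or_ne k 0 with rfl | hk0
        · simp
        · have := hz3 k hk hk0
          simp only [LSeries.term_of_ne_zero hk0, ← mul_div_assoc]
          rw [← Finset.sum_div, this, zero_div]
    rw [h3] at h1
    exact eq_neg_of_add_eq_zero_left h1
  have hnorm : ‖A z‖ * (N : ℝ) ^ (-z.re) ≤
      Real.exp (δ / 8 * r) * (((N + 1 : ℕ) : ℝ) ^ (x - z.re) * M) := by
    have h1 : ‖A z * (N : ℂ) ^ (-z)‖ = ‖A z‖ * (N : ℝ) ^ (-z.re) := by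
      rw [norm_mul, Complex.norm_natCast_cpow_of_pos (Nat.pos_of_ne_zero hn), Complex.neg_re]
    rw [← h1, hlead, norm_neg, hM, Finset.mul_sum, Finset.mul_sum]
    refine (norm_sum_le _ _).trans (Finset.sum_le_sum fun i hi ↦ ?_)
    rw [norm_mul]
    gcongr
    · exact hci i hi
    · exact norm_tsum_LSeries_term_tail_le (hD i hi) hxz N.succ_pos
  have hApos : 0 < ‖A z‖ := norm_pos_iff.2 hz2
  have hAlow : Real.exp (-(δ / 8 * r)) ≤ ‖A z‖ := by
    rw [Real.exp_neg]
    exact (inv_le_comm₀ hApos (Real.exp_pos _)).1 hAi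
  have h1 : Real.exp (-(δ / 8 * r)) * (N : ℝ) ^ (-z.re) ≤
      Real.exp (δ / 8 * r) * (((N + 1 : ℕ) : ℝ) ^ (x - z.re) * M) :=
    (mul_le_mul_of_nonneg_right hAlow (by positivity)).trans hnorm
  have hN1 : (0 : ℝ) < (N + 1 : ℕ) := by positivity
  rw [Real.rpow_def_of_pos hNpos, Real.rpow_def_of_pos hN1] at h1
  have h2 : Real.exp (δ / 4 * r) ≤ M * Real.exp (x * Real.log ((N + 1 : ℕ) : ℝ)) := by
    have h3 : Real.exp (δ / 4 * r) ≤ Real.exp (δ * z.re - δ / 4 * r) := by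
      apply Real.exp_le_exp.2
      nlinarith
    refine h3.trans ?_
    calc Real.exp (δ * z.re - δ / 4 * r)
        = (Real.exp (-(δ / 8 * r)) * Real.exp (Real.log N * -z.re)) *
            Real.exp (Real.log ((N + 1 : ℕ) : ℝ) * z.re - δ / 8 * r) := by
          rw [← Real.exp_add, ← Real.exp_add]; congr 1; rw [hδ]; ring
      _ ≤ (Real.exp (δ / 8 * r) * (Real.exp (Real.log ((N + 1 : ℕ) : ℝ) * (x - z.re)) * M)) *
            Real.exp (Real.log ((N + 1 : ℕ) : ℝ) * z.re - δ / 8 * r) := by gcongr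
      _ = M * (Real.exp (δ / 8 * r) * Real.exp (Real.log ((N + 1 : ℕ) : ℝ) * (x - z.re)) *
            Real.exp (Real.log ((N + 1 : ℕ) : ℝ) * z.re - δ / 8 * r)) := by ring
      _ = _ := by
          rw [← Real.exp_add, ← Real.exp_add]; congr 2; ring
  exact absurd hr (not_lt.2 h2)

/-- The Riemann zeta function satisfies no nontrivial algebraic difference equation whose
coefficients have order less than one. -/
theorem not_satisfiesAlgebraicDifferenceEquation_riemannZeta :
    ¬ SatisfiesAlgebraicDifferenceEquation {φ | nevanlinnaOrder φ < 1} riemannZeta := by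
  rintro ⟨m, a, f, ha, hf, ⟨K₀, hK₀⟩, heq⟩
  obtain ⟨x, hx⟩ : ∃ x : ℝ, ∀ i, 1 < x + (a i).re := by
    obtain ⟨B, hB⟩ := (Set.finite_range fun i ↦ 2 - (a i).re).bddAbove
    exact ⟨B, fun i ↦ by linarith [hB ⟨i, rfl⟩]⟩
  have hrel : ∀ᶠ z in codiscrete ℂ, x ≤ z.re →
      ∑ K ∈ f.support, f.coeff K z * LSeries (zetaMonomial a K) z = 0 := by
    filter_upwards [heq] with z hz hxz
    rw [MvPolynomial.eval_eq', Finset.sum_apply] at hz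
    refine Eq.trans ?_ hz
    refine Finset.sum_congr rfl fun K _ ↦ ?_
    rw [(LSeriesHasSum_zetaMonomial K fun i ↦ ?_).LSeries_eq]
    · simp [Finset.prod_apply]
    · rw [Complex.add_re]; linarith [hx i]
  -- A countable intersection of codiscrete sets need not be codiscrete; passing to null sets allows
  -- all `n` at one point `z`.
  have hae : ∀ᵐ z : ℂ, ∀ n : ℕ, ∑ K ∈ f.support, f.coeff K z * zetaMonomial a K n = 0 := by
    rw [ae_all_iff]
    intro n
    rcases eq_or_ne n 0 with rfl | hn
    · simp
    have h1 := sum_mul_coeff_eventuallyEq_zero f.support (fun K _ ↦ (hf K).1)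
      (fun K _ ↦ characteristic_isLittleO_of_nevanlinnaOrder_lt_one (hf K).2)
      (fun K _ ↦ (LSeriesHasSum_zetaMonomial K (s := (x : ℂ)) fun i ↦ by
        simpa using hx i).LSeriesSummable) hrel hn
    have h2 := (ae_restrict_le_codiscreteWithin (μ := (volume : Measure ℂ)) MeasurableSet.univ) h1
    rw [Measure.restrict_univ] at h2
    filter_upwards [h2] with z hz
    simpa using hz
  have hne : ∀ᵐ z : ℂ, f.coeff K₀ z ≠ 0 := by
    have h2 := (ae_restrict_le_codiscreteWithin (μ := (volume : Measure ℂ)) MeasurableSet.univ)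
      ((hf K₀).1.eventually_codiscrete_ne_zero hK₀)
    rwa [Measure.restrict_univ] at h2
  obtain ⟨z, hz1, hz2⟩ := (hae.and hne).exists
  refine hz2 (zetaMonomial_linearIndependent ha f.support (fun K ↦ f.coeff K z) hz1 K₀ ?_)
  rw [MvPolynomial.mem_support_iff]
  exact fun h ↦ hz2 (by rw [h]; rfl)

end

/-! ### Growth of `(s - 1) ζ(s)` -/

section

open ValueDistribution MeasureTheory Asymptotics

/-- The fractional part, cut off to `(1, ∞)`. -/
noncomputable def fractIoiOne (t : ℝ) : ℂ :=
  (Set.Ioi (1 : ℝ)).indicator (fun t ↦ ((Int.fract t : ℝ) : ℂ)) t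

theorem measurable_fractIoiOne : Measurable fractIoiOne :=
  (Complex.measurable_ofReal.comp measurable_fract).indicator measurableSet_Ioi

theorem norm_fractIoiOne_le (t : ℝ) : ‖fractIoiOne t‖ ≤ 1 := by
  unfold fractIoiOne
  by_cases ht : t ∈ Set.Ioi (1 : ℝ)
  · rw [Set.indicator_of_mem ht, Complex.norm_real, Real.norm_of_nonneg (Int.fract_nonneg t)]
    exact (Int.fract_lt_one t).le
  · rw [Set.indicator_of_notMem ht]; simp

theorem mellin_fractIoiOne_neg (s : ℂ) : mellin fractIoiOne (-s) =
    ∫ t in Set.Ioi (1 : ℝ), (t : ℂ) ^ (-(s + 1)) * ((Int.fract t : ℝ) : ℂ) := by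
  have h : ∀ t : ℝ, (t : ℂ) ^ (-s - 1) • fractIoiOne t = (Set.Ioi (1 : ℝ)).indicator
      (fun t : ℝ ↦ (t : ℂ) ^ (-(s + 1)) * ((Int.fract t : ℝ) : ℂ)) t := by
    intro t
    by_cases ht : t ∈ Set.Ioi (1 : ℝ)
    · rw [Set.indicator_of_mem ht, fractIoiOne, Set.indicator_of_mem ht, smul_eq_mul]
      congr 2; ring
    · rw [Set.indicator_of_notMem ht, fractIoiOne, Set.indicator_of_notMem ht, smul_zero]
  rw [mellin]
  simp_rw [h]
  rw [setIntegral_indicator measurableSet_Ioi, Set.inter_eq_right.2 (Set.Ioi_subset_Ioi zero_le_one)]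

theorem differentiableAt_mellin_fractIoiOne_neg {s : ℂ} (hs : 0 < s.re) :
    DifferentiableAt ℂ (fun s ↦ mellin fractIoiOne (-s)) s := by
  have h : DifferentiableAt ℂ (mellin fractIoiOne) (-s) := by
    -- Boundedness at infinity gives `a = 0`. Near zero the function vanishes, so any `b` below `-Re
    -- s` serves.
    refine mellin_differentiableAt_of_isBigO_rpow (a := 0) (b := -s.re - 1) ?_ ?_ (by simpa) ?_
      (by simp)
    · have hl : LocallyIntegrable fractIoiOne := by
        refine (locallyIntegrable_const (1 : ℝ)).mono
          measurable_fractIoiOne.aestronglyMeasurable (ae_of_all _ fun t ↦ ?_)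
        simpa using norm_fractIoiOne_le t
      exact hl.locallyIntegrableOn _
    · refine .of_bound 1 (Eventually.of_forall fun t ↦ ?_)
      simpa using norm_fractIoiOne_le t
    · refine (isBigO_zero _ _).congr' (f₁ := fun _ ↦ (0 : ℂ)) ?_ .rfl
      filter_upwards [nhdsWithin_le_nhds (Iio_mem_nhds zero_lt_one)] with t ht
      rw [fractIoiOne, Set.indicator_of_notMem (Set.notMem_Ioi.2 (Set.mem_Iio.1 ht).le)]
  exact DifferentiableAt.fun_comp' s h differentiableAt_id.neg

/-- The integrand is dominated by `t ^ (-3 / 2)`, whose integral over `(1, ∞)` is `2`. -/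
theorem norm_mellin_fractIoiOne_neg_le {s : ℂ} (hs : 1 / 2 ≤ s.re) :
    ‖mellin fractIoiOne (-s)‖ ≤ 2 := by
  rw [mellin_fractIoiOne_neg]
  have hint : IntegrableOn (fun t : ℝ ↦ t ^ (-(3 / 2) : ℝ)) (Set.Ioi 1) :=
    integrableOn_Ioi_rpow_of_lt (by norm_num) zero_lt_one
  have hle : ∀ᵐ t : ℝ ∂volume.restrict (Set.Ioi 1),
      ‖(t : ℂ) ^ (-(s + 1)) * ((Int.fract t : ℝ) : ℂ)‖ ≤ t ^ (-(3 / 2) : ℝ) := by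
    filter_upwards [ae_restrict_mem measurableSet_Ioi] with t ht
    have ht1 : (1 : ℝ) < t := ht
    rw [norm_mul, Complex.norm_cpow_eq_rpow_re_of_pos (by linarith), Complex.norm_real,
      Real.norm_of_nonneg (Int.fract_nonneg t)]
    calc t ^ (-(s + 1)).re * Int.fract t ≤ t ^ (-(3 / 2) : ℝ) * 1 := by
          gcongr
          · exact ht1.le
          · simp; linarith
          · exact (Int.fract_lt_one t).le
      _ = _ := mul_one _
  refine (norm_integral_le_of_norm_le hint hle).trans ?_
  rw [integral_Ioi_rpow_of_lt (by norm_num) zero_lt_one]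
  norm_num

/-- Abel summation gives `ζ(s) = s ∫ ⌊t⌋ t ^ (-s - 1) dt` over `(1, ∞)`; then split `⌊t⌋` as `t`
minus its fractional part. -/
theorem riemannZeta_eq_sub_mellin {s : ℂ} (hs : 1 < s.re) :
    riemannZeta s = s / (s - 1) - s * mellin fractIoiOne (-s) := by
  have hs1 : s - 1 ≠ 0 := fun h ↦ by
    have := congrArg Complex.re h
    simp at this; linarith
  have hO : (fun n : ℕ ↦ ∑ k ∈ Finset.Icc 1 n, ‖(1 : ℕ → ℂ) k‖) =O[atTop]
      fun n ↦ (n : ℝ) ^ (1 : ℝ) := by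
    simpa using isBigO_refl _ _
  have h1 := LSeries_eq_mul_integral' (1 : ℕ → ℂ) zero_le_one hs hO
  rw [LSeries_one_eq_riemannZeta hs] at h1
  rw [h1, mellin_fractIoiOne_neg]
  have hint1 : IntegrableOn (fun t : ℝ ↦ (t : ℂ) ^ (-s)) (Set.Ioi 1) :=
    integrableOn_Ioi_cpow_of_lt (by simpa) zero_lt_one
  have hint0 : IntegrableOn (fun t : ℝ ↦ (t : ℂ) ^ (-(s + 1))) (Set.Ioi 1) :=
    integrableOn_Ioi_cpow_of_lt (by simp; linarith) zero_lt_one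
  have hint2 : IntegrableOn
      (fun t : ℝ ↦ (t : ℂ) ^ (-(s + 1)) * ((Int.fract t : ℝ) : ℂ)) (Set.Ioi 1) := by
    refine Integrable.mono hint0 (hint0.aestronglyMeasurable.mul
      (Complex.measurable_ofReal.comp measurable_fract).aestronglyMeasurable)
      (ae_of_all _ fun t ↦ ?_)
    rw [norm_mul, Complex.norm_real, Real.norm_of_nonneg (Int.fract_nonneg t)]
    exact mul_le_of_le_one_right (norm_nonneg _) (Int.fract_lt_one t).le
  have heq : ∫ t in Set.Ioi (1 : ℝ), (∑ k ∈ Finset.Icc 1 ⌊t⌋₊, (1 : ℕ → ℂ) k) *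
      (t : ℂ) ^ (-(s + 1)) = ∫ t in Set.Ioi (1 : ℝ), ((t : ℂ) ^ (-s) -
        (t : ℂ) ^ (-(s + 1)) * ((Int.fract t : ℝ) : ℂ)) := by
    refine setIntegral_congr_fun measurableSet_Ioi fun t ht ↦ ?_
    have ht0 : (0 : ℝ) < t := lt_trans zero_lt_one ht
    have htc : (t : ℂ) ≠ 0 := by exact_mod_cast ht0.ne'
    have hfl : ((⌊t⌋₊ : ℕ) : ℂ) = (t : ℂ) - ((Int.fract t : ℝ) : ℂ) := by
      rw [← Int.self_sub_floor, ← natCast_floor_eq_intCast_floor ht0.le]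
      push_cast; ring
    have hcp : (t : ℂ) ^ (-s) = (t : ℂ) ^ (-(s + 1)) * t := by
      rw [show -s = -(s + 1) + 1 by ring, Complex.cpow_add _ _ htc, Complex.cpow_one]
    simp only [Pi.one_apply, Finset.sum_const, Nat.card_Icc, nsmul_eq_mul, mul_one,
      Nat.add_sub_cancel]
    rw [hfl, hcp]; ring
  rw [heq, integral_sub hint1 hint2, integral_Ioi_cpow_of_lt (by simpa) zero_lt_one]
  have hs1' : -s + 1 ≠ 0 := fun h ↦ hs1 (by linear_combination -h)
  simp only [Complex.ofReal_one, Complex.one_cpow]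
  field_simp
  ring

/-- Multiplying by `s - 1` removes the pole, so the identity theorem carries the formula from `Re s
> 1` to `Re s > 0`. -/
theorem riemannZeta₁_eq {s : ℂ} (hs : 0 < s.re) :
    riemannZeta₁ s = s - s * (s - 1) * mellin fractIoiOne (-s) := by
  have hopen : IsOpen {s : ℂ | 0 < s.re} := isOpen_lt continuous_const Complex.continuous_re
  have hf : AnalyticOnNhd ℂ riemannZeta₁ {s : ℂ | 0 < s.re} :=
    differentiable_riemannZeta₁.differentiableOn.analyticOnNhd hopen
  have hg : AnalyticOnNhd ℂ (fun s ↦ s - s * (s - 1) * mellin fractIoiOne (-s))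
      {s : ℂ | 0 < s.re} := by
    refine DifferentiableOn.analyticOnNhd (fun z hz ↦ DifferentiableAt.differentiableWithinAt ?_)
      hopen
    have := differentiableAt_mellin_fractIoiOne_neg hz
    fun_prop
  refine hf.eqOn_of_preconnected_of_eventuallyEq hg
    (convex_halfSpace_re_gt 0).isPreconnected (z₀ := 2) (by simp) ?_ hs
  have h2 : {s : ℂ | 1 < s.re} ∈ 𝓝 (2 : ℂ) :=
    (isOpen_lt continuous_const Complex.continuous_re).mem_nhds (by simp)
  filter_upwards [h2] with z hz
  have hz1 : z ≠ 1 := fun h ↦ by simp [h] at hz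
  have h3 := riemannZeta_eq_inv_sub_mul hz1
  rw [riemannZeta_eq_sub_mellin hz] at h3
  have hz1' := sub_ne_zero.2 hz1
  field_simp at h3
  linear_combination -h3

theorem norm_riemannZeta₁_le_of_half_le_re {s : ℂ} (hs : 1 / 2 ≤ s.re) :
    ‖riemannZeta₁ s‖ ≤ ‖s‖ + 2 * (‖s‖ * ‖s - 1‖) := by
  rw [riemannZeta₁_eq (by linarith)]
  refine (norm_sub_le _ _).trans ?_
  rw [norm_mul, norm_mul]
  have := norm_mellin_fractIoiOne_neg_le hs
  nlinarith [mul_nonneg (norm_nonneg s) (norm_nonneg (s - 1))]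

theorem Complex.norm_Gamma_le_Gamma_re {s : ℂ} (hs : 0 < s.re) : ‖Gamma s‖ ≤ Real.Gamma s.re := by
  rw [Complex.Gamma_eq_integral hs, Real.Gamma_eq_integral hs, Complex.GammaIntegral]
  refine norm_integral_le_of_norm_le (Real.GammaIntegral_convergent hs) ?_
  filter_upwards [ae_restrict_mem measurableSet_Ioi] with t ht
  rw [norm_mul, Complex.norm_real, Real.norm_of_nonneg (Real.exp_pos _).le,
    Complex.norm_cpow_eq_rpow_re_of_pos ht]
  simp

/-- Convexity bounds `Γ` on `[1 / 2, n + 1]` by its endpoint values `√π` and `n!`. -/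
theorem Real.Gamma_le_rpow_self {x R : ℝ} (hx : 1 / 2 ≤ x) (hxR : x ≤ R) (hR : 1 ≤ R) :
    Real.Gamma x ≤ (R + 1) ^ (R + 1) := by
  set n := ⌊R⌋₊ + 1 with hn
  have hnR : (n : ℝ) ≤ R + 1 := by
    rw [hn]; push_cast; linarith [Nat.floor_le (show (0 : ℝ) ≤ R by linarith)]
  have hxn : x ≤ (n : ℝ) + 1 := by
    rw [hn]; push_cast; linarith [Nat.lt_floor_add_one R]
  have hmax := Real.convexOn_Gamma.le_max_of_mem_Icc (x := 1 / 2) (y := (n : ℝ) + 1)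
    (Set.mem_Ioi.2 (by norm_num)) (Set.mem_Ioi.2 (by positivity)) ⟨hx, hxn⟩
  refine hmax.trans (max_le ?_ ?_)
  · rw [Real.Gamma_one_half_eq]
    have h1 : √Real.pi ≤ 2 := by
      rw [Real.sqrt_le_left (by norm_num)]; linarith [Real.pi_lt_four]
    have h2 : (R + 1) ^ (1 : ℝ) ≤ (R + 1) ^ (R + 1) :=
      Real.rpow_le_rpow_of_exponent_le (by linarith) (by linarith)
    rw [Real.rpow_one] at h2
    linarith
  · rw [Real.Gamma_nat_eq_factorial]
    calc (n.factorial : ℝ) ≤ (n : ℝ) ^ n := by exact_mod_cast Nat.factorial_le_pow n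
      _ ≤ (R + 1) ^ n := by gcongr
      _ = (R + 1) ^ (n : ℝ) := (Real.rpow_natCast _ _).symm
      _ ≤ _ := Real.rpow_le_rpow_of_exponent_le (by linarith) hnR

theorem Complex.norm_cos_le_exp_norm (z : ℂ) : ‖Complex.cos z‖ ≤ Real.exp ‖z‖ := by
  rw [Complex.cos, norm_div]
  have h1 := Complex.norm_exp_le_exp_norm (z * I)
  have h2 := Complex.norm_exp_le_exp_norm (-z * I)
  rw [norm_mul, Complex.norm_I, mul_one] at h1 h2
  rw [norm_neg] at h2
  have := norm_add_le (Complex.exp (z * I)) (Complex.exp (-z * I))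
  rw [Complex.norm_ofNat, div_le_iff₀ (by norm_num)]
  linarith

/-- The exponent of a bound for `(s - 1) ζ(s)` in the disc of radius `R`. -/
noncomputable def zetaGrowth (R : ℝ) : ℝ := (R + 1) * Real.log (R + 1) + 11 * R

theorem zetaGrowth_monotoneOn : MonotoneOn zetaGrowth (Set.Ici 0) := by
  intro a ha b hb hab
  have ha0 : 0 ≤ a := ha
  have hb0 : 0 ≤ b := hb
  unfold zetaGrowth
  have : 0 ≤ Real.log (a + 1) := Real.log_nonneg (by linarith)
  gcongr

theorem le_zetaGrowth {R : ℝ} (hR : 0 ≤ R) : 11 * R ≤ zetaGrowth R := by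
  have : 0 ≤ Real.log (R + 1) := Real.log_nonneg (by linarith)
  have : 0 ≤ (R + 1) * Real.log (R + 1) := by positivity
  unfold zetaGrowth; linarith

/-- For `Re s ≥ 1 / 2` the growth is polynomial. Otherwise the functional equation reflects to `w =
1 - s`, where the Gamma factor produces the term of size `R log R`. The hypothesis `1 ≤ ‖s‖`
controls the factor `1 / (w - 1) = -1 / s`. -/
theorem norm_riemannZeta₁_le {s : ℂ} (hs : 1 ≤ ‖s‖) :
    ‖riemannZeta₁ s‖ ≤ Real.exp (zetaGrowth (‖s‖ + 1)) := by
  set R := ‖s‖ + 1 with hR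
  have hR2 : 2 ≤ R := by linarith
  have hs1 : ‖s - 1‖ ≤ R := by simpa using norm_sub_le s 1
  have hpoly : ∀ {w : ℂ}, 1 / 2 ≤ w.re → ‖w‖ ≤ R → ‖w - 1‖ ≤ R → ‖riemannZeta₁ w‖ ≤ 3 * R ^ 2 := by
    intro w hw h1 h2
    have := norm_riemannZeta₁_le_of_half_le_re hw
    have h3 : ‖w‖ * ‖w - 1‖ ≤ R * R := by gcongr
    nlinarith
  have hRexp : R ≤ Real.exp R := by linarith [Real.add_one_le_exp R]
  have hexp6 : 6 ≤ Real.exp (6 * R) := by linarith [Real.add_one_le_exp (6 * R)]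
  rcases le_or_gt (1 / 2) s.re with hre | hre
  · refine (hpoly hre (by linarith) hs1).trans ?_
    calc 3 * R ^ 2 ≤ Real.exp (6 * R) * Real.exp R ^ 2 := by gcongr; linarith
      _ = Real.exp (8 * R) := by rw [← Real.exp_nat_mul, ← Real.exp_add]; congr 1; push_cast; ring
      _ ≤ _ := Real.exp_le_exp.2 (by linarith [le_zetaGrowth (show 0 ≤ R by linarith)])
  · have hs0 : s ≠ 0 := fun h ↦ by rw [h] at hs; norm_num at hs
    have hsne1 : s ≠ 1 := fun h ↦ by rw [h] at hre; norm_num at hre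
    set w := 1 - s with hw
    have hwre : 1 / 2 ≤ w.re := by simp [hw]; linarith
    have hwR : ‖w‖ ≤ R := by rw [hw, norm_sub_rev]; exact hs1
    have hw1 : w - 1 = -s := by rw [hw]; ring
    have hwne1 : w ≠ 1 := fun h ↦ hs0 (by rw [h, sub_self] at hw1; simpa using hw1.symm)
    have hfe : riemannZeta s = 2 * (2 * Real.pi) ^ (-w) * Complex.Gamma w *
        Complex.cos (Real.pi * w / 2) * riemannZeta w := by
      rw [← riemannZeta_one_sub (s := w) (fun n h ↦ ?_) hwne1]
      · congr 1; rw [hw]; ring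
      · have := congrArg Complex.re h
        simp only [Complex.neg_re, Complex.natCast_re] at this
        have : (0 : ℝ) ≤ n := by positivity
        linarith
    have hζ₁ : riemannZeta₁ s = (s - 1) * riemannZeta s := by
      rw [riemannZeta_eq_inv_sub_mul hsne1, mul_inv_cancel_left₀ (sub_ne_zero.2 hsne1)]
    rw [hζ₁, hfe, riemannZeta_eq_inv_sub_mul hwne1, hw1]
    have h1 : ‖((2 : ℂ) * Real.pi) ^ (-w)‖ ≤ 1 := by
      have : ((2 : ℂ) * Real.pi) = ((2 * Real.pi : ℝ) : ℂ) := by push_cast; rfl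
      rw [this, Complex.norm_cpow_eq_rpow_re_of_pos (by positivity)]
      exact Real.rpow_le_one_of_one_le_of_nonpos (by linarith [Real.pi_gt_three])
        (by simp only [Complex.neg_re]; linarith)
    have h2 : ‖Complex.Gamma w‖ ≤ Real.exp ((R + 1) * Real.log (R + 1)) := by
      refine (Complex.norm_Gamma_le_Gamma_re (by linarith)).trans ?_
      refine (Real.Gamma_le_rpow_self hwre ((Complex.re_le_norm w).trans hwR) (by linarith)).trans ?_
      rw [Real.rpow_def_of_pos (by linarith), mul_comm]
    have h3 : ‖Complex.cos (Real.pi * w / 2)‖ ≤ Real.exp (2 * R) := by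
      refine (Complex.norm_cos_le_exp_norm _).trans (Real.exp_le_exp.2 ?_)
      rw [norm_div, norm_mul, Complex.norm_real, Real.norm_of_nonneg Real.pi_pos.le,
        Complex.norm_ofNat]
      nlinarith [Real.pi_lt_four, Real.pi_pos, norm_nonneg w]
    have h4 : ‖(-s)⁻¹‖ ≤ 1 := by
      rw [norm_inv, norm_neg]; exact inv_le_one_of_one_le₀ hs
    have h5 : ‖riemannZeta₁ w‖ ≤ 3 * R ^ 2 := hpoly hwre hwR (by rw [hw1, norm_neg]; linarith)
    simp only [norm_mul, Complex.norm_ofNat]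
    -- The `11 R` in `zetaGrowth` is `6 R` for the constant `6`, `3 R` for `R ^ 3` and `2 R` for the
    -- cosine.
    calc ‖s - 1‖ * (2 * ‖((2 : ℂ) * Real.pi) ^ (-w)‖ * ‖Complex.Gamma w‖ *
          ‖Complex.cos (Real.pi * w / 2)‖ * (‖(-s)⁻¹‖ * ‖riemannZeta₁ w‖))
        ≤ R * (2 * 1 * Real.exp ((R + 1) * Real.log (R + 1)) * Real.exp (2 * R) *
          (1 * (3 * R ^ 2))) := by gcongr
      _ = 6 * R ^ 3 * (Real.exp ((R + 1) * Real.log (R + 1)) * Real.exp (2 * R)) := by ring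
      _ ≤ Real.exp (6 * R) * Real.exp R ^ 3 *
          (Real.exp ((R + 1) * Real.log (R + 1)) * Real.exp (2 * R)) := by gcongr
      _ = Real.exp (zetaGrowth R) := by
          rw [← Real.exp_nat_mul, ← Real.exp_add, ← Real.exp_add, ← Real.exp_add, zetaGrowth]
          congr 1; push_cast; ring

end

/-! ### The order of `ζ(s + 1) / ζ(s)` and the linear equation -/

section

open ValueDistribution MeasureTheory Asymptotics

/-- The characteristic of an entire function is bounded by its growth. -/
theorem characteristic_le_of_forall_norm_le {g : ℂ → ℂ} (hg : Differentiable ℂ g) {r B : ℝ}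
    (hr : 0 ≤ r) (hB : 0 ≤ B) (h : ∀ z, ‖z‖ = r → ‖g z‖ ≤ Real.exp B) :
    characteristic g ⊤ r ≤ B := by
  have hN : logCounting g ⊤ = 0 := by
    have : 0 ≤ MeromorphicOn.divisor g Set.univ :=
      MeromorphicOn.AnalyticOnNhd.divisor_nonneg
        (hg.differentiableOn.analyticOnNhd isOpen_univ)
    rw [logCounting_top, negPart_eq_zero.2 this, map_zero]
  rw [characteristic, hN, add_zero, proximity_top]
  have hm : MeromorphicOn g (Metric.sphere 0 |r|) := fun z _ ↦ (hg.analyticAt z).meromorphicAt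
  refine Real.circleAverage_mono_on_of_le_circle hm.circleIntegrable_posLog_norm fun z hz ↦ ?_
  rw [mem_sphere_zero_iff_norm, abs_of_nonneg hr] at hz
  rw [Real.posLog_def]
  refine max_le hB ?_
  rcases eq_or_ne (g z) 0 with h0 | h0
  · simpa [h0] using hB
  · exact (Real.log_le_iff_le_exp (norm_pos_iff.2 h0)).2 (h z hz)

theorem Differentiable.meromorphic {g : ℂ → ℂ} (hg : Differentiable ℂ g) : Meromorphic g :=
  fun z ↦ (hg.analyticAt z).meromorphicAt

theorem Differentiable.forall_meromorphicOrderAt_ne_top {g : ℂ → ℂ} (hg : Differentiable ℂ g)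
    {z₀ : ℂ} (h : g z₀ ≠ 0) (z : ℂ) : meromorphicOrderAt g z ≠ ⊤ := by
  revert z
  rw [← hg.meromorphic.exists_meromorphicOrderAt_ne_top_iff_forall]
  refine ⟨z₀, (meromorphicOrderAt_ne_top_iff_eventually_ne_zero (hg.meromorphic z₀)).2 ?_⟩
  exact nhdsWithin_le_nhds (hg.continuous.continuousAt.eventually_ne h)

theorem exists_characteristic_inv_le {g : ℂ → ℂ} (hg : Meromorphic g) :
    ∃ c : ℝ, ∀ r, characteristic g⁻¹ ⊤ r ≤ characteristic g ⊤ r + c := by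
  refine ⟨max |Real.log ‖g 0‖| |Real.log ‖meromorphicTrailingCoeffAt g 0‖|, fun r ↦ ?_⟩
  have := (abs_le.1 (characteristic_sub_characteristic_inv_le hg (R := r))).1
  linarith

theorem riemannZeta_add_one_div_eventuallyEq :
    (fun s ↦ riemannZeta (s + 1) / riemannZeta s) =ᶠ[codiscrete ℂ]
      ((fun s ↦ riemannZeta₁ (s + 1)) * (fun s ↦ s - 1)) * ((fun s ↦ s) * riemannZeta₁)⁻¹ := by
  filter_upwards [(Set.toFinite ({0, 1} : Set ℂ)).compl_mem_codiscrete] with s hs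
  simp only [Set.mem_compl_iff, Set.mem_insert_iff, Set.mem_singleton_iff, not_or] at hs
  rw [riemannZeta_eq_inv_sub_mul hs.2, riemannZeta_eq_inv_sub_mul (by simpa using hs.1)]
  simp only [Pi.mul_apply, Pi.inv_apply, add_sub_cancel_right]
  field_simp

/-- The quotient is built from four entire factors, each contributing one `zetaGrowth (r + 2)`;
inverting the denominator costs only the constant `c`. The argument `r + 2` absorbs the shift by one
and the `+ 1` in the growth bound, and `2 ≤ r` keeps `‖z + 1‖ ≥ 1`. -/
theorem exists_characteristic_riemannZeta_add_one_div_le :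
    ∃ c : ℝ, ∀ r, 2 ≤ r → characteristic (fun s ↦ riemannZeta (s + 1) / riemannZeta s) ⊤ r ≤
      4 * zetaGrowth (r + 2) + c := by
  have hd₁ : Differentiable ℂ fun s ↦ riemannZeta₁ (s + 1) := by fun_prop
  have hd₂ : Differentiable ℂ fun s : ℂ ↦ s - 1 := by fun_prop
  have hd₃ : Differentiable ℂ fun s : ℂ ↦ s := by fun_prop
  have hd₄ : Differentiable ℂ riemannZeta₁ := differentiable_riemannZeta₁
  have ho₁ := hd₁.forall_meromorphicOrderAt_ne_top (z₀ := 0) (by simp)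
  have ho₂ := hd₂.forall_meromorphicOrderAt_ne_top (z₀ := 0) (by simp)
  have ho₃ := hd₃.forall_meromorphicOrderAt_ne_top (z₀ := 1) (by simp)
  have ho₄ := hd₄.forall_meromorphicOrderAt_ne_top (z₀ := 1) (by simp)
  have hmul {f g : ℂ → ℂ} (hf : Meromorphic f) (hg : Meromorphic g)
      (hf' : ∀ z, meromorphicOrderAt f z ≠ ⊤) (hg' : ∀ z, meromorphicOrderAt g z ≠ ⊤) (z : ℂ) :
      meromorphicOrderAt (f * g) z ≠ ⊤ := by
    rw [meromorphicOrderAt_mul (hf z) (hg z)]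
    exact WithTop.add_ne_top.2 ⟨hf' z, hg' z⟩
  have hm₁₂ := hd₁.meromorphic.mul hd₂.meromorphic
  have hm₃₄ := hd₃.meromorphic.mul hd₄.meromorphic
  have ho₁₂ := hmul hd₁.meromorphic hd₂.meromorphic ho₁ ho₂
  have ho₃₄ := hmul hd₃.meromorphic hd₄.meromorphic ho₃ ho₄
  obtain ⟨c, hc⟩ := exists_characteristic_inv_le hm₃₄
  refine ⟨c, fun r hr ↦ ?_⟩
  have hr1 : 1 ≤ r := by linarith
  have hB : 11 * (r + 2) ≤ zetaGrowth (r + 2) := le_zetaGrowth (by linarith)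
  have hB0 : 0 ≤ zetaGrowth (r + 2) := by linarith
  have hmono {a : ℝ} (ha : 0 ≤ a) (h : a ≤ r + 2) : zetaGrowth a ≤ zetaGrowth (r + 2) :=
    zetaGrowth_monotoneOn ha (show (0 : ℝ) ≤ r + 2 by linarith) h
  have hexp : r + 2 ≤ Real.exp (zetaGrowth (r + 2)) := by
    linarith [Real.add_one_le_exp (zetaGrowth (r + 2))]
  have h₁ := characteristic_le_of_forall_norm_le hd₁ (by linarith) hB0 (r := r) fun z hz ↦ by
    have h1 : ‖z + 1‖ ≤ r + 1 := by simpa [hz] using norm_add_le z 1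
    have h2 : r - 1 ≤ ‖z + 1‖ := by simpa [hz] using norm_sub_le_norm_add z 1
    exact (norm_riemannZeta₁_le (by linarith)).trans
      (Real.exp_le_exp.2 (hmono (by positivity) (by linarith)))
  have h₂ := characteristic_le_of_forall_norm_le hd₂ (by linarith) hB0 (r := r) fun z hz ↦ by
    have h1 : ‖z - 1‖ ≤ r + 1 := by simpa [hz] using norm_sub_le z 1
    linarith
  have h₃ := characteristic_le_of_forall_norm_le hd₃ (by linarith) hB0 (r := r) fun z hz ↦ by
    linarith
  have h₄ := characteristic_le_of_forall_norm_le hd₄ (by linarith) hB0 (r := r) fun z hz ↦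
    (norm_riemannZeta₁_le (by linarith)).trans
      (Real.exp_le_exp.2 (hmono (by positivity) (by linarith)))
  have h₁₂ := characteristic_mul_top_le hr1 hd₁.meromorphic ho₁ hd₂.meromorphic ho₂
  have h₃₄ := characteristic_mul_top_le hr1 hd₃.meromorphic ho₃ hd₄.meromorphic ho₄
  have h := characteristic_mul_top_le hr1 hm₁₂ ho₁₂ hm₃₄.inv
    (fun z ↦ by rw [meromorphicOrderAt_inv]; simpa [-mul_inv_rev] using ho₃₄ z)
  rw [Pi.add_apply] at h h₁₂ h₃₄
  rw [characteristic_congr_codiscrete riemannZeta_add_one_div_eventuallyEq (by linarith)]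
  linarith [hc r]

theorem zetaGrowth_add_two_isLittleO {q : ℝ} (hq : 1 < q) :
    (fun r : ℝ ↦ zetaGrowth (r + 2)) =o[atTop] fun r : ℝ ↦ r ^ q := by
  have hlog : Real.log =o[atTop] fun r : ℝ ↦ r ^ (q - 1) :=
    isLittleO_log_rpow_atTop (sub_pos.2 hq)
  have hmul : (fun r : ℝ ↦ r * Real.log r) =o[atTop] fun r : ℝ ↦ r ^ q := by
    refine ((isBigO_refl (fun r : ℝ ↦ r) atTop).mul_isLittleO hlog).congr' .rfl ?_
    filter_upwards [eventually_gt_atTop (0 : ℝ)] with r hr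
    nth_rewrite 1 [← Real.rpow_one r]
    rw [← Real.rpow_add hr, add_sub_cancel]
  -- `26 = 4 + 22`, from `r + 3 ≤ 2 r`, `log (r + 3) ≤ 2 log r` and `11 (r + 2) ≤ 22 r log r`.
  refine IsBigO.trans_isLittleO (.of_bound 26 ?_) hmul
  filter_upwards [eventually_ge_atTop (3 : ℝ), eventually_ge_atTop (Real.exp 1)] with r hr hre
  have hlog1 : 1 ≤ Real.log r := (Real.le_log_iff_exp_le (by linarith)).2 hre
  have hB := le_zetaGrowth (show 0 ≤ r + 2 by linarith)
  rw [Real.norm_of_nonneg (by linarith), Real.norm_of_nonneg (by positivity), zetaGrowth]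
  have hlog2 : Real.log (r + 2 + 1) ≤ 2 * Real.log r := by
    rw [← Real.log_rpow (by linarith)]
    refine Real.log_le_log (by linarith) ?_
    norm_num
    nlinarith
  have h1 : (r + 2 + 1) * Real.log (r + 2 + 1) ≤ (2 * r) * (2 * Real.log r) :=
    mul_le_mul (by linarith) hlog2 (Real.log_nonneg (by linarith)) (by linarith)
  nlinarith

theorem nevanlinnaOrder_riemannZeta_add_one_div_le :
    nevanlinnaOrder (fun s ↦ riemannZeta (s + 1) / riemannZeta s) ≤ 1 := by
  obtain ⟨c, hc⟩ := exists_characteristic_riemannZeta_add_one_div_le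
  refine nevanlinnaOrder_le_of_forall_gt zero_le_one fun q hq ↦ ?_
  have ho : (fun r : ℝ ↦ 4 * zetaGrowth (r + 2) + c) =o[atTop] fun r : ℝ ↦ r ^ q :=
    ((zetaGrowth_add_two_isLittleO hq).const_mul_left 4).add <|
      isLittleO_const_left.2 <| .inr <|
        tendsto_norm_atTop_atTop.comp (tendsto_rpow_atTop (by linarith))
  filter_upwards [ho.def one_pos, eventually_ge_atTop (2 : ℝ)] with r hr hr2
  rw [one_mul, Real.norm_of_nonneg (Real.rpow_nonneg (by linarith) q)] at hr
  exact ((hc r hr2).trans (le_abs_self _)).trans hr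

theorem meromorphic_riemannZeta_add_one_div :
    Meromorphic fun s ↦ riemannZeta (s + 1) / riemannZeta s := by
  rw [meromorphic_congr_codiscrete riemannZeta_add_one_div_eventuallyEq]
  have hd₁ : Differentiable ℂ fun s ↦ riemannZeta₁ (s + 1) := by fun_prop
  have hd₂ : Differentiable ℂ fun s : ℂ ↦ s - 1 := by fun_prop
  have hd₃ : Differentiable ℂ fun s : ℂ ↦ s := by fun_prop
  exact (hd₁.meromorphic.mul hd₂.meromorphic).mul
    (hd₃.meromorphic.mul differentiable_riemannZeta₁.meromorphic).inv

theorem riemannZeta_eventually_codiscrete_ne_zero : ∀ᶠ s in codiscrete ℂ, riemannZeta s ≠ 0 := by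
  have h : riemannZetaZerosᶜ ∈ codiscrete ℂ := mem_codiscrete'.2
    ⟨isClosed_riemannZetaZeros.isOpen_compl, by simpa using isDiscrete_riemannZetaZeros⟩
  exact h

/-- `ζ` satisfies the linear equation `ζ(s + 1) = φ(s) ζ(s)` with `φ(s) = ζ(s + 1) / ζ(s)`. -/
theorem satisfiesAlgebraicDifferenceEquation_riemannZeta {C : Set (ℂ → ℂ)}
    (h0 : (fun _ ↦ 0) ∈ C) (h1 : (fun _ ↦ -1) ∈ C)
    (hφ : (fun s ↦ riemannZeta (s + 1) / riemannZeta s) ∈ C) :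
    SatisfiesAlgebraicDifferenceEquation C riemannZeta := by
  set φ : ℂ → ℂ := fun s ↦ riemannZeta (s + 1) / riemannZeta s with hφdef
  set k₀ : Fin 2 →₀ ℕ := Finsupp.single 0 1
  set k₁ : Fin 2 →₀ ℕ := Finsupp.single 1 1
  have hk : k₀ ≠ k₁ := fun h ↦ by simpa [k₀, k₁] using DFunLike.congr_fun h 0
  set f : MvPolynomial (Fin 2) (ℂ → ℂ) :=
    MvPolynomial.monomial k₀ φ + MvPolynomial.monomial k₁ (fun _ ↦ -1)
  have hcoeff : ∀ K, f.coeff K = if k₀ = K then φ else if k₁ = K then fun _ ↦ -1 else fun _ ↦ 0 := by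
    intro K
    simp only [f, MvPolynomial.coeff_add, MvPolynomial.coeff_monomial]
    split_ifs with h h' h'
    · exact absurd (h.trans h'.symm) hk
    · rw [add_zero]
    · rw [zero_add]
    · rw [add_zero]; rfl
  refine ⟨1, ![0, 1], f, ?_, fun K ↦ ?_, ⟨k₁, ?_⟩, ?_⟩
  · intro i j hij
    fin_cases i <;> fin_cases j <;> simp_all
  · rw [hcoeff]
    split_ifs
    · exact ⟨meromorphic_riemannZeta_add_one_div, hφ⟩
    · exact ⟨Meromorphic.const _, h1⟩
    · exact ⟨Meromorphic.const _, h0⟩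
  · rw [hcoeff, if_neg hk, if_pos rfl]
    intro h
    have h' := (ae_restrict_le_codiscreteWithin (μ := (volume : Measure ℂ)) MeasurableSet.univ) h
    rw [Measure.restrict_univ] at h'
    obtain ⟨z, hz⟩ := Eventually.exists h'
    simp at hz
  · filter_upwards [riemannZeta_eventually_codiscrete_ne_zero] with s hs
    simp only [f, k₀, k₁, map_add, MvPolynomial.eval_monomial]
    simp [hφdef, hs]

end

/-- The Riemann zeta function satisfies no nontrivial algebraic difference equation with
meromorphic coefficients of Nevanlinna order less than one, and the bound is sharp: the function
`ζ(s + 1) / ζ(s)` has order one, and `ζ` does satisfy a nontrivial algebraic difference equation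
with meromorphic coefficients of order at most one. -/
theorem corollary1 :
    ¬ SatisfiesAlgebraicDifferenceEquation {φ | nevanlinnaOrder φ < 1} riemannZeta ∧
    nevanlinnaOrder (fun s ↦ riemannZeta (s + 1) / riemannZeta s) = 1 ∧
    SatisfiesAlgebraicDifferenceEquation {φ | nevanlinnaOrder φ ≤ 1} riemannZeta := by
  have h0 : nevanlinnaOrder (fun _ ↦ 0) = 0 := nevanlinnaOrder_const_of_norm_le_one (by simp)
  have h1 : nevanlinnaOrder (fun _ ↦ -1) = 0 := nevanlinnaOrder_const_of_norm_le_one (by simp)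
  have hle := nevanlinnaOrder_riemannZeta_add_one_div_le
  refine ⟨not_satisfiesAlgebraicDifferenceEquation_riemannZeta, hle.antisymm ?_,
    satisfiesAlgebraicDifferenceEquation_riemannZeta (by simp [h0]) (by simp [h1]) hle⟩
  -- If the quotient had order below one, the linear equation would have all its coefficients `φ`,
  -- `-1`, `0` of order below one, contradicting the impossibility result.
  by_contra! hlt
  exact not_satisfiesAlgebraicDifferenceEquation_riemannZeta
    (satisfiesAlgebraicDifferenceEquation_riemannZeta (by simp [h0]) (by simp [h1]) hlt)
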